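/- A Polish group is a topological group whose topology is separable and completely metrizable. It is monothetic if it contains a dense cyclic subgroup. A Polish group $P$ is called Hilbert-representable if there are a complex Hilbert space $\mathcal{H}$ and a group homomorphism $P \to \mathcal{U}(\mathcal{H})$ that is a homeomorphism onto its image, where the unitary group $\mathcal{U}(\mathcal{H})$ carries the strong operator topology. Let $P$ be a Hilbert-representable Polish monothetic group and let $K \subset P$ be a compact subgroup. Then $K$ is normal in $P$, the quotient group $P/K$ with the quotient topology is a Polish group, and $P/K$ is Hilbert-representable. -/

import Mathlib

universe u v w

/-- The strong operator topology on the unitary group `𝒰(H)` of a complex inner product space `H`: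
the coarsest topology for which every evaluation `U ↦ U x`, `x : H`, is continuous into `H` with its
norm topology. (The topology that Mathlib puts on `unitary (H →L[ℂ] H)` is the norm topology.) -/
abbrev unitaryStrongTopology (H : Type v) [NormedAddCommGroup H] [InnerProductSpace ℂ H]
    [CompleteSpace H] : TopologicalSpace (unitary (H →L[ℂ] H)) :=
  TopologicalSpace.induced (fun (U : unitary (H →L[ℂ] H)) (x : H) => (U : H →L[ℂ] H) x)
    Pi.topologicalSpace

/-- A topological group `P` is Hilbert-representable if there are a complex Hilbert space `H` and a
group homomorphism from `P` to the unitary group of `H` that is a homeomorphism onto its image, where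
the unitary group carries the strong operator topology. -/
def HilbertRepresentable (P : Type u) [Group P] [TopologicalSpace P] : Prop :=
  ∃ (H : Type v) (_ : NormedAddCommGroup H) (_ : InnerProductSpace ℂ H) (_ : CompleteSpace H)
    (ρ : P →* unitary (H →L[ℂ] H)),
    @Topology.IsEmbedding P (unitary (H →L[ℂ] H)) _ (unitaryStrongTopology H) ρ

/-- A topological group is monothetic if it has a dense cyclic subgroup. -/
def IsMonothetic (P : Type u) [Group P] [TopologicalSpace P] : Prop :=
  ∃ g : P, DenseRange (fun n : ℤ => g ^ n)

/-!
A second countable Hausdorff group is Hilbert-representable exactly when its continuous positive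
definite functions control the neighbourhoods of the identity: for every neighbourhood `V` of `1`
there are such a function `φ` and `c > 0` with `φ 1 - φ g < c → g ∈ V`. For a representation `ρ`
take `φ g = ∑ x ∈ I, Re ⟪x, ρ g x⟫` over a finite set `I` of vectors
(`HilbertRepresentable.exists_isPositiveDefinite`). Conversely, on a second countable group a
weighted sum of countably many such functions is a single `φ` doing the job for all `V`, and the
Gelfand–Naimark–Segal representation of `φ` is a topological embedding
(`hilbertRepresentable_of_forall_exists_isPositiveDefinite`). Its Hilbert space is separable,
hence isometric to some `ℓ²(S)` with `S` countable, and so is available in every universe.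

The property passes to the quotient by a compact central subgroup `K`
(`exists_isPositiveDefinite_quotient`). If `φ` controls `V`, then for `N > 0` so does
`exp (N * φ)`, which is positive definite by the Schur product theorem. Its average over the Haar
probability measure of `K` is again positive definite, because `K` is central, and it descends to
`P ⧸ K`. Outside `V * K` the average is at most `exp (N * (φ 1 - c))`, whereas at the identity it
is at least `exp (N * (φ 1 - c / 2))` times the measure of a neighbourhood of `1` in `K`, which is
larger as soon as `N` is large. Exponentiating before averaging is what makes the average
separate: the average of `φ` itself only sees the `K`-invariant vectors, and may well vanish.

A monothetic Hausdorff group is commutative, so every subgroup is normal and central. The quotient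
of a Polish group by a compact subgroup is Polish because sending a coset to itself embeds the
quotient as a closed subspace of the space of nonempty compact sets with the Vietoris topology
(`polishSpace_quotient_of_isCompact`).
-/

open Topology TopologicalSpace Filter MeasureTheory

/-! ### Quotients of Polish groups by compact subgroups -/

/-- A compact subgroup as a nonempty compact subset of the ambient group. -/
def Subgroup.toNonemptyCompacts {P : Type u} [Group P] [TopologicalSpace P] (K : Subgroup P)
    (hK : IsCompact (K : Set P)) : NonemptyCompacts P :=
  ⟨⟨K, hK⟩, ⟨1, K.one_mem⟩⟩

theorem PolishSpace.nonemptyCompacts (X : Type u) [TopologicalSpace X] [PolishSpace X] :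
    PolishSpace (NonemptyCompacts X) := by
  let := upgradeIsCompletelyMetrizable X
  infer_instance

/-- The left cosets of a compact subgroup form a Polish space: `g K`, viewed as a compact set,
depends continuously on `g` in the Vietoris topology, and the set of all cosets is closed there. -/
theorem polishSpace_quotient_of_isCompact {P : Type u} [Group P] [TopologicalSpace P]
    [IsTopologicalGroup P] [PolishSpace P] (K : Subgroup P) (hK : IsCompact (K : Set P)) :
    PolishSpace (P ⧸ K) := by
  have := PolishSpace.nonemptyCompacts P
  let K' := K.toNonemptyCompacts hK
  have mem_K' : ∀ x, x ∈ (K' : Set P) ↔ x ∈ K := fun x => Iff.rfl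
  let p : P → NonemptyCompacts P := fun g => K'.map (fun k => g * k) (by fun_prop)
  have hp : Continuous p :=
    Continuous.nonemptyCompacts_map' (f := fun _ => K') (g := fun g k => g * k)
      continuous_const continuous_mul
  have mem_p : ∀ g x, x ∈ (p g : Set P) ↔ g⁻¹ * x ∈ K := by
    intro g x
    simp only [p, NonemptyCompacts.coe_map, Set.mem_image, mem_K']
    exact ⟨by rintro ⟨k, hk, rfl⟩; simpa using hk, fun h => ⟨_, h, by simp⟩⟩
  let Ψ : P ⧸ K → NonemptyCompacts P := Quotient.lift p (by
    intro a b hab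
    have hab : a⁻¹ * b ∈ K := QuotientGroup.leftRel_apply.mp hab
    refine NonemptyCompacts.ext (Set.ext fun x => ?_)
    rw [mem_p, mem_p]
    have : a⁻¹ * x = (a⁻¹ * b) * (b⁻¹ * x) := by group
    rw [this, K.mul_mem_cancel_left hab])
  have hΨ : Continuous Ψ := hp.quotient_lift _
  have Ψ_mk : ∀ g : P, Ψ (g : P ⧸ K) = p g := fun g => rfl
  have ind : IsInducing Ψ := by
    refine isInducing_iff_nhds.mpr fun a => le_antisymm (hΨ.tendsto a).le_comap ?_
    induction a using QuotientGroup.induction_on with | H g =>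
    intro O hO
    obtain ⟨O', hO', hopen, hg⟩ := mem_nhds_iff.mp hO
    -- The compact sets inside the preimage of an open set form a Vietoris open set.
    refine mem_comap.mpr ⟨{C | (C : Set P) ⊆ (QuotientGroup.mk : P → P ⧸ K) ⁻¹' O'},
      (NonemptyCompacts.isOpen_subsets_of_isOpen
        (hopen.preimage continuous_quotient_mk')).mem_nhds ?_, ?_⟩
    · intro x hx
      rw [Ψ_mk, mem_p] at hx
      have e : (g : P ⧸ K) = x := QuotientGroup.eq.mpr hx
      change (x : P ⧸ K) ∈ O'
      rwa [← e]
    · intro b hb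
      induction b using QuotientGroup.induction_on with | H h =>
      exact hO' (hb ((mem_p h h).mpr (by simp)))
  have inj : Function.Injective Ψ := by
    intro a b
    induction a using QuotientGroup.induction_on with | H g =>
    induction b using QuotientGroup.induction_on with | H h =>
    intro hab
    rw [Ψ_mk, Ψ_mk] at hab
    refine QuotientGroup.eq.mpr ((mem_p g h).mp ?_)
    rw [hab]
    exact (mem_p h h).mpr (by simp)
  -- The cosets are the nonempty `C` with `C * K = C` and `C⁻¹ * C ⊆ K`, two closed conditions.
  have ran : Set.range Ψ = {C : NonemptyCompacts P |
      (C ×ˢ K').map (fun x : P × P => x.1 * x.2) continuous_mul = C} ∩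
      {C | (((C ×ˢ C).map (fun x : P × P => x.1⁻¹ * x.2) (by fun_prop) :
        NonemptyCompacts P) : Set P) ⊆ K} := by
    ext C
    constructor
    · rintro ⟨a, rfl⟩
      induction a using QuotientGroup.induction_on with | H g =>
      rw [Ψ_mk]
      constructor
      · refine NonemptyCompacts.ext (Set.ext fun x => ?_)
        simp only [NonemptyCompacts.coe_map, NonemptyCompacts.coe_prod, Set.mem_image,
          Set.mem_prod, mem_p, mem_K', Prod.exists]
        constructor
        · rintro ⟨a, b, ⟨ha, hb⟩, rfl⟩
          simpa [mul_assoc] using K.mul_mem ha hb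
        · intro hx
          exact ⟨x, 1, ⟨hx, K.one_mem⟩, mul_one x⟩
      · rintro x hx
        simp only [NonemptyCompacts.coe_map, NonemptyCompacts.coe_prod, Set.mem_image,
          Set.mem_prod, mem_p, Prod.exists] at hx
        obtain ⟨a, b, ⟨ha, hb⟩, rfl⟩ := hx
        simpa [mul_assoc] using K.mul_mem (K.inv_mem ha) hb
    · rintro ⟨h1, h2⟩
      obtain ⟨c, hc⟩ := C.nonempty
      refine ⟨(c : P ⧸ K), NonemptyCompacts.ext (Set.ext fun x => ?_)⟩
      rw [Ψ_mk, mem_p]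
      constructor
      · intro hx
        rw [← (show _ = C from h1)]
        simp only [NonemptyCompacts.coe_map, NonemptyCompacts.coe_prod, Set.mem_image,
          Set.mem_prod, mem_K', Prod.exists]
        exact ⟨c, c⁻¹ * x, ⟨hc, hx⟩, by simp⟩
      · intro hx
        refine h2 ?_
        simp only [NonemptyCompacts.coe_map, NonemptyCompacts.coe_prod, Set.mem_image,
          Set.mem_prod, Prod.exists]
        exact ⟨c, x, ⟨hc, hx⟩, rfl⟩
  have closed : IsClosed (Set.range Ψ) := by
    rw [ran]
    have hKc : IsClosed (K : Set P) := hK.isClosed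
    refine IsClosed.inter (isClosed_eq ?_ continuous_id) ?_
    · exact (Continuous.nonemptyCompacts_map continuous_mul).comp
        (NonemptyCompacts.continuous_prod.comp (continuous_id.prodMk continuous_const))
    · exact (NonemptyCompacts.isClosed_subsets_of_isClosed hKc).preimage
        ((Continuous.nonemptyCompacts_map (by fun_prop)).comp
        (NonemptyCompacts.continuous_prod.comp (continuous_id.prodMk continuous_id)))
  exact IsClosedEmbedding.polishSpace ⟨⟨ind, inj⟩, closed⟩

/-! ### Positive definite kernels and functions -/

namespace Matrix.PosSemidef

variable {ι : Type*}

theorem of_tendsto {α : Type*} {l : Filter α} [l.NeBot] {A : α → Matrix ι ι ℝ} {B : Matrix ι ι ℝ}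
    (hA : ∀ a, (A a).PosSemidef) (h : ∀ i j, Tendsto (fun a => A a i j) l (𝓝 (B i j))) :
    B.PosSemidef := by
  refine ⟨Matrix.ext fun i j => ?_, fun x => ?_⟩
  · refine tendsto_nhds_unique ((h j i).congr fun a => ?_) (h i j)
    simpa using (hA a).1.apply i j
  · refine ge_of_tendsto' (x := l)
      (f := fun a => x.sum fun i xi => x.sum fun j xj => star xi * A a i j * xj) ?_
      fun a => (hA a).2 x
    exact tendsto_finsetSum _ fun i _ => tendsto_finsetSum _ fun j _ =>
      ((h i j).const_mul _).mul_const _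

/-- The real part of a complex Gram kernel is positive semidefinite. -/
theorem of_re_inner {H : Type*} [NormedAddCommGroup H] [InnerProductSpace ℂ H] (f : ι → H) :
    (Matrix.of fun i j => (inner ℂ (f i) (f j)).re).PosSemidef := by
  refine ⟨Matrix.ext fun i j => ?_, fun x => ?_⟩
  · simpa using inner_re_symm (𝕜 := ℂ) (f j) (f i)
  · have : (x.sum fun i xi => x.sum fun j xj => star xi * (inner ℂ (f i) (f j)).re * xj) =
        (inner ℂ (x.sum fun i xi => (xi : ℂ) • f i) (x.sum fun i xi => (xi : ℂ) • f i)).re := by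
      simp only [Finsupp.sum, sum_inner, inner_sum, inner_smul_left, inner_smul_right,
        Complex.re_sum, Complex.conj_ofReal, Complex.re_ofReal_mul, star_trivial]
      refine Finset.sum_congr rfl fun i _ => ?_
      rw [Finset.mul_sum]
      refine Finset.sum_congr rfl fun j _ => ?_
      rw [show (inner ℂ (f i) (f j)).re = (inner ℂ (f j) (f i)).re from
        inner_re_symm (𝕜 := ℂ) (f i) (f j)]
      ring
    exact this.trans_ge (inner_self_nonneg (𝕜 := ℂ))

/-- The defining sum may be taken over any finite set containing the support. -/
theorem sum_nonneg {A : Matrix ι ι ℝ} (hA : A.PosSemidef) (x : ι →₀ ℝ) {s : Finset ι}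
    (hs : x.support ⊆ s) : 0 ≤ ∑ i ∈ s, ∑ j ∈ s, x i * A i j * x j := by
  have := hA.2 x
  rw [Finsupp.sum_of_support_subset _ hs _ (by simp)] at this
  refine this.trans_eq (Finset.sum_congr rfl fun i _ => ?_)
  rw [Finsupp.sum_of_support_subset _ hs _ (by simp)]
  simp

theorem map_pow {A : Matrix ι ι ℝ} (hA : A.PosSemidef) (n : ℕ) : (A.map (· ^ n)).PosSemidef := by
  induction n with
  | zero =>
    convert of_re_inner (fun _ : ι => (1 : ℂ)) using 1
    ext i j
    simp
  | succ n ih =>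
    have : A.map (· ^ (n + 1)) = (A.map (· ^ n)).hadamard A := by
      ext i j
      simp [pow_succ]
    rw [this]
    exact ih.hadamard hA

/-- By the Schur product theorem the entrywise powers are positive semidefinite; the entrywise
exponential is a limit of nonnegative combinations of them. -/
theorem map_exp {A : Matrix ι ι ℝ} (hA : A.PosSemidef) : (A.map Real.exp).PosSemidef := by
  refine of_tendsto (l := atTop)
    (A := fun N : ℕ => ∑ n ∈ Finset.range N, ((n.factorial : ℝ)⁻¹ • A.map (· ^ n)))
    (fun N => Matrix.posSemidef_sum _ fun n _ => (hA.map_pow n).smul (by positivity))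
    fun i j => ?_
  have := (NormedSpace.expSeries_div_hasSum_exp (A i j)).tendsto_sum_nat
  simp only [Matrix.sum_apply, Matrix.smul_apply, Matrix.map_apply, smul_eq_mul]
  rw [Real.exp_eq_exp_ℝ]
  refine this.congr fun N => Finset.sum_congr rfl fun n _ => ?_
  rw [div_eq_inv_mul]

end Matrix.PosSemidef

/-- A real-valued function on a group is positive definite if the kernel `(g, h) ↦ φ (g⁻¹ * h)` is
symmetric and positive semidefinite. -/
def IsPositiveDefinite {G : Type*} [Group G] (φ : G → ℝ) : Prop :=
  (Matrix.of fun g h => φ (g⁻¹ * h)).PosSemidef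

namespace IsPositiveDefinite

variable {G : Type*} [Group G]

theorem smul {φ : G → ℝ} (h : IsPositiveDefinite φ) {c : ℝ} (hc : 0 ≤ c) :
    IsPositiveDefinite fun g => c * φ g :=
  Matrix.PosSemidef.smul h hc

theorem exp {φ : G → ℝ} (h : IsPositiveDefinite φ) : IsPositiveDefinite fun g => Real.exp (φ g) :=
  Matrix.PosSemidef.map_exp h

theorem sum {α : Type*} (s : Finset α) {φ : α → G → ℝ} (h : ∀ a ∈ s, IsPositiveDefinite (φ a)) :
    IsPositiveDefinite fun g => ∑ a ∈ s, φ a g := by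
  have : (Matrix.of fun g k => ∑ a ∈ s, φ a (g⁻¹ * k)) =
      ∑ a ∈ s, Matrix.of fun g k => φ a (g⁻¹ * k) := by
    ext
    simp [Matrix.sum_apply]
  rw [IsPositiveDefinite, this]
  exact Matrix.posSemidef_sum s h

theorem of_hasSum {φ : ℕ → G → ℝ} {ψ : G → ℝ} (h : ∀ n, IsPositiveDefinite (φ n))
    (hs : ∀ g, HasSum (fun n => φ n g) (ψ g)) : IsPositiveDefinite ψ :=
  Matrix.PosSemidef.of_tendsto (l := atTop) (fun N : ℕ => sum (Finset.range N) fun n _ => h n)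
    fun i j => (hs (i⁻¹ * j)).tendsto_sum_nat

theorem of_inner {φ : G → ℝ} {H : Type*} [NormedAddCommGroup H] [InnerProductSpace ℂ H]
    (f : G → H) (h : ∀ g₁ g₂, φ (g₁⁻¹ * g₂) = (inner ℂ (f g₁) (f g₂)).re) :
    IsPositiveDefinite φ := by
  simpa only [IsPositiveDefinite, h] using Matrix.PosSemidef.of_re_inner f

/-- A positive definite function is the Gram kernel of a map `f` into a complex Hilbert space in
which the values of `f` are total, namely the reproducing kernel Hilbert space of `φ (g⁻¹ * h)`. -/
theorem exists_feature {G : Type u} [Group G] {φ : G → ℝ} (h : IsPositiveDefinite φ) :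
    ∃ (H : Type u) (_ : NormedAddCommGroup H) (_ : InnerProductSpace ℂ H) (_ : CompleteSpace H)
      (f : G → H), (∀ g₁ g₂, inner ℂ (f g₁) (f g₂) = (φ (g₁⁻¹ * g₂) : ℂ)) ∧
        (Submodule.span ℂ (Set.range f)).topologicalClosure = ⊤ := by
  let K : Matrix G G (ℂ →L[ℂ] ℂ) := Matrix.of fun g h => (φ (g⁻¹ * h) : ℂ) • 1
  have symm : ∀ g k, φ (g⁻¹ * k) = φ (k⁻¹ * g) := fun g k => by
    simpa using h.1.apply k g
  have hK : K.PosSemidef := by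
    have iff := (RKHS.posSemidef_tfae (K := K)).out 0 2
    refine iff.mpr ⟨?_, fun x => ?_⟩
    · ext g k
      simp [K, Matrix.conjTranspose_apply, symm g k]
    -- For a real symmetric kernel, the real and imaginary parts of the coefficients decouple.
    · have re_nonneg := Matrix.PosSemidef.sum_nonneg h (x.mapRange Complex.re Complex.zero_re)
        (s := x.support) Finsupp.support_mapRange
      have im_nonneg := Matrix.PosSemidef.sum_nonneg h (x.mapRange Complex.im Complex.zero_im)
        (s := x.support) Finsupp.support_mapRange
      refine (add_nonneg re_nonneg im_nonneg).trans_eq ?_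
      simp only [Finsupp.sum, map_sum, ← Finset.sum_add_distrib]
      refine Finset.sum_congr rfl fun i _ => Finset.sum_congr rfl fun j _ => ?_
      simp [K, symm j i]
      ring
  have : Fact K.PosSemidef := ⟨hK⟩
  refine ⟨RKHS.OfKernel K, inferInstance, inferInstance, inferInstance,
    fun g => RKHS.kerFun (RKHS.OfKernel K) g 1, fun g₁ g₂ => ?_, ?_⟩
  · rw [← RKHS.kernel_inner, RKHS.OfKernel.kernel_ofKernel]
    simp [K, symm g₁ g₂]
  · rw [← top_le_iff, ← RKHS.kerFun_dense (RKHS.OfKernel K)]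
    refine Submodule.topologicalClosure_mono (Submodule.span_le.mpr ?_)
    rintro _ ⟨g, c, rfl⟩
    have : RKHS.kerFun (RKHS.OfKernel K) g c = c • RKHS.kerFun (RKHS.OfKernel K) g 1 := by
      rw [← map_smul, smul_eq_mul, mul_one]
    rw [this]
    exact Submodule.smul_mem _ _ (Submodule.subset_span ⟨g, rfl⟩)

end IsPositiveDefinite

/-! ### From positive definite functions to unitary representations and back -/

/-- Distinct orthonormal vectors are at distance `√2`, so they form a discrete subset. -/
theorem Orthonormal.countable_of_separableSpace {ι H : Type*} [NormedAddCommGroup H]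
    [InnerProductSpace ℂ H] [SeparableSpace H] {b : ι → H} (hb : Orthonormal ℂ b) :
    Countable ι := by
  have : SecondCountableTopology H := UniformSpace.secondCountable_of_separable H
  have : DiscreteTopology (Set.range b) := by
    refine DiscreteTopology.of_forall_le_dist zero_lt_one ?_
    rintro ⟨_, i, rfl⟩ ⟨_, j, rfl⟩ hij
    have hij : i ≠ j := fun h => hij (by simp [h])
    have h1 : ‖b i - b j‖ ^ 2 = 2 := by
      rw [norm_sub_sq (𝕜 := ℂ), hb.1 i, hb.1 j, hb.2 hij]
      norm_num
    rw [Subtype.dist_eq, dist_eq_norm]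
    nlinarith [norm_nonneg (b i - b j)]
  have : Countable (Set.range b) := countable_of_Lindelof_of_discrete
  exact (Equiv.ofInjective b hb.linearIndependent.injective).countable_iff.mpr this

/-- A separable Hilbert space has an isometric copy in every universe. -/
theorem exists_linearIsometryEquiv_of_separableSpace (H : Type u) [NormedAddCommGroup H]
    [InnerProductSpace ℂ H] [CompleteSpace H] [SeparableSpace H] :
    ∃ (H' : Type w) (_ : NormedAddCommGroup H') (_ : InnerProductSpace ℂ H') (_ : CompleteSpace H'),
      Nonempty (H ≃ₗᵢ[ℂ] H') := by
  obtain ⟨s, b, -⟩ := exists_hilbertBasis ℂ H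
  have : Countable s := b.orthonormal.countable_of_separableSpace
  obtain ⟨i, hi⟩ := exists_injective_nat s
  let e : ULift.{w} (Set.range i) ≃ s := Equiv.ulift.trans (Equiv.ofInjective i hi).symm
  let b' : HilbertBasis (ULift.{w} (Set.range i)) ℂ H :=
    HilbertBasis.mk (b.orthonormal.comp e e.injective) (by
      rw [e.surjective.range_comp, b.dense_span])
  exact ⟨_, _, _, inferInstance, ⟨b'.repr⟩⟩

namespace IsPositiveDefinite

variable {G : Type u} [Group G] {φ : G → ℝ}

section Feature

variable {H : Type*} [NormedAddCommGroup H] [InnerProductSpace ℂ H] {f : G → H}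

theorem norm_feature_sub_sq (hf : ∀ g₁ g₂, inner ℂ (f g₁) (f g₂) = (φ (g₁⁻¹ * g₂) : ℂ))
    (g₁ g₂ : G) : ‖f g₁ - f g₂‖ ^ 2 = 2 * (φ 1 - φ (g₁⁻¹ * g₂)) := by
  have h : ∀ g, ‖f g‖ ^ 2 = φ 1 := fun g => by
    rw [← inner_self_eq_norm_sq (𝕜 := ℂ), hf]
    simp
  rw [norm_sub_sq (𝕜 := ℂ), h, h, hf]
  simp only [RCLike.re_eq_complex_re, Complex.ofReal_re]
  ring

theorem continuous_feature [TopologicalSpace G] [IsTopologicalGroup G] (hφ : Continuous φ)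
    (hf : ∀ g₁ g₂, inner ℂ (f g₁) (f g₂) = (φ (g₁⁻¹ * g₂) : ℂ)) : Continuous f := by
  refine continuous_iff_continuousAt.mpr fun g => ?_
  refine tendsto_iff_norm_sub_tendsto_zero.mpr ?_
  have h : Continuous fun k => √(2 * (φ 1 - φ (k⁻¹ * g))) := by fun_prop
  have h' := h.tendsto g
  simp only [inv_mul_cancel, sub_self, mul_zero, Real.sqrt_zero] at h'
  refine h'.congr fun k => ?_
  rw [← norm_feature_sub_sq hf, Real.sqrt_sq (norm_nonneg _)]

end Feature

theorem apply_le_apply_one (h : IsPositiveDefinite φ) (g : G) : φ g ≤ φ 1 := by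
  obtain ⟨H, _, _, _, f, hf, -⟩ := h.exists_feature
  have := norm_feature_sub_sq hf 1 g
  rw [inv_one, one_mul] at this
  nlinarith [sq_nonneg ‖f 1 - f g‖]

theorem apply_one_nonneg (h : IsPositiveDefinite φ) : 0 ≤ φ 1 := by
  simpa using Matrix.PosSemidef.diag_nonneg h (i := 1)

theorem neg_apply_one_le_apply (h : IsPositiveDefinite φ) (g : G) : -φ 1 ≤ φ g := by
  obtain ⟨H, _, _, _, f, hf, -⟩ := h.exists_feature
  have h1 : ‖f 1‖ ^ 2 = φ 1 := by
    rw [← inner_self_eq_norm_sq (𝕜 := ℂ), hf]; simp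
  have h2 : ‖f g‖ ^ 2 = φ 1 := by
    rw [← inner_self_eq_norm_sq (𝕜 := ℂ), hf]; simp
  have := norm_add_sq (𝕜 := ℂ) (f 1) (f g)
  rw [h1, h2, hf] at this
  simp only [inv_one, one_mul, RCLike.re_eq_complex_re, Complex.ofReal_re] at this
  nlinarith [sq_nonneg ‖f 1 + f g‖]

/-- For a continuous positive definite function on a separable group, the space of the feature map
can be found in any universe. -/
theorem exists_feature_of_separableSpace [TopologicalSpace G] [IsTopologicalGroup G]
    [SeparableSpace G] (h : IsPositiveDefinite φ) (hφ : Continuous φ) :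
    ∃ (H : Type w) (_ : NormedAddCommGroup H) (_ : InnerProductSpace ℂ H) (_ : CompleteSpace H)
      (f : G → H), (∀ g₁ g₂, inner ℂ (f g₁) (f g₂) = (φ (g₁⁻¹ * g₂) : ℂ)) ∧
        (Submodule.span ℂ (Set.range f)).topologicalClosure = ⊤ := by
  obtain ⟨H, _, _, _, f, hf, hd⟩ := h.exists_feature
  have : SeparableSpace H := by
    rw [← isSeparable_univ_iff]
    have := (isSeparable_range (continuous_feature hφ hf)).span (R := ℂ) |>.closure
    rwa [← Submodule.topologicalClosure_coe, hd] at this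
  obtain ⟨H', _, _, _, ⟨e⟩⟩ := exists_linearIsometryEquiv_of_separableSpace.{u, w} H
  refine ⟨H', inferInstance, inferInstance, inferInstance, fun g => e (f g),
    fun g₁ g₂ => by rw [e.inner_map_map, hf], ?_⟩
  have hd' : Dense (Submodule.span ℂ (Set.range f) : Set H) :=
    Submodule.dense_iff_topologicalClosure_eq_top.mpr hd
  refine Submodule.dense_iff_topologicalClosure_eq_top.mp ?_
  have hd'' := e.surjective.denseRange.dense_image e.continuous hd'
  change Dense ((Submodule.span ℂ (Set.range f)).map e.toLinearEquiv.toLinearMap : Set H') at hd''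
  rwa [Submodule.map_span, ← Set.range_comp] at hd''

end IsPositiveDefinite

section Representation

variable {G : Type u} [Group G] {H : Type w} [NormedAddCommGroup H] [InnerProductSpace ℂ H]
  [CompleteSpace H]

/-- A map `f` with total range whose Gram kernel is left invariant extends to a unitary
representation translating `f`. -/
theorem exists_representation_of_inner_left_invariant {f : G → H}
    (hf : ∀ g g₁ g₂, inner ℂ (f (g * g₁)) (f (g * g₂)) = inner ℂ (f g₁) (f g₂))
    (hd : (Submodule.span ℂ (Set.range f)).topologicalClosure = ⊤) :
    ∃ ρ : G →* unitary (H →L[ℂ] H), ∀ g k, (ρ g : H →L[ℂ] H) (f k) = f (g * k) := by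
  let T : (G →₀ ℂ) →ₗ[ℂ] H := Finsupp.linearCombination ℂ f
  have hT : DenseRange T := by
    have : Dense (Submodule.span ℂ (Set.range f) : Set H) :=
      Submodule.dense_iff_topologicalClosure_eq_top.mpr hd
    rw [← Finsupp.range_linearCombination] at this
    exact this
  let L : G → (G →₀ ℂ) ≃ₗ[ℂ] (G →₀ ℂ) := fun g => Finsupp.domLCongr (Equiv.mulLeft g)
  have hTL : ∀ g x, T (L g x) = x.sum fun k c => c • f (g * k) := by
    intro g x
    simp [T, L, Finsupp.linearCombination_apply, Finsupp.domLCongr_apply, Finsupp.domCongr_apply,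
      Finsupp.sum_equivMapDomain]
  have hnorm : ∀ g x, ‖T (L g x)‖ = ‖T x‖ := by
    intro g x
    have : inner ℂ (T (L g x)) (T (L g x)) = inner ℂ (T x) (T x) := by
      rw [hTL]
      simp only [T, Finsupp.linearCombination_apply, Finsupp.sum, sum_inner, inner_sum,
        inner_smul_left, inner_smul_right, hf]
    rw [@norm_eq_sqrt_re_inner ℂ, @norm_eq_sqrt_re_inner ℂ, this]
  let U : G → H ≃ₗᵢ[ℂ] H := fun g => (L g).extendOfIsometry T T hT hT (hnorm g)
  have hU : ∀ g k, U g (f k) = f (g * k) := by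
    intro g k
    have h1 : f k = T (Finsupp.single k 1) := by simp [T]
    rw [h1, LinearEquiv.extendOfIsometry_eq, hTL]
    simp
  have ext_U : ∀ V W : H ≃ₗᵢ[ℂ] H, (∀ k, V (f k) = W (f k)) → V = W := by
    intro V W h
    refine LinearIsometryEquiv.ext fun x => ?_
    refine congrFun (hT.equalizer V.continuous W.continuous (funext fun y => ?_)) x
    simp only [Function.comp_apply, T, Finsupp.linearCombination_apply, Finsupp.sum, map_sum,
      map_smul, h]
  let R : G →* H ≃ₗᵢ[ℂ] H :=
    { toFun := U
      map_one' := ext_U _ _ fun k => by rw [hU]; simp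
      map_mul' := fun g₁ g₂ => ext_U _ _ fun k => by
        rw [LinearIsometryEquiv.coe_mul, Function.comp_apply, hU, hU, hU, mul_assoc] }
  exact ⟨Unitary.linearIsometryEquiv.symm.toMonoidHom.comp R, hU⟩

/-- Strong continuity of a family of unitaries can be tested on a total set of vectors. -/
theorem continuous_unitary_apply_of_dense {X : Type*} [TopologicalSpace X]
    (ρ : X → unitary (H →L[ℂ] H)) {S : Set H}
    (hS : (Submodule.span ℂ S).topologicalClosure = ⊤)
    (h : ∀ x ∈ S, Continuous fun g => (ρ g : H →L[ℂ] H) x) (x : H) :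
    Continuous fun g => (ρ g : H →L[ℂ] H) x := by
  have hspan : ∀ y ∈ Submodule.span ℂ S, Continuous fun g => (ρ g : H →L[ℂ] H) y := by
    intro y hy
    induction hy using Submodule.span_induction with
    | mem y hy => exact h y hy
    | zero => simpa using continuous_const
    | add y z _ _ hy hz => simpa using! hy.add hz
    | smul c y _ hy => simpa using! hy.const_smul c
  have hd : Dense (Submodule.span ℂ S : Set H) :=
    Submodule.dense_iff_topologicalClosure_eq_top.mpr hS
  refine continuous_of_uniform_approx_of_continuous fun u hu => ?_
  obtain ⟨ε, hε, hεu⟩ := Metric.mem_uniformity_dist.mp hu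
  obtain ⟨y, hy, hxy⟩ := hd.exists_dist_lt x hε
  refine ⟨_, hspan y hy, fun g => hεu ?_⟩
  rwa [dist_eq_norm, ← map_sub, Unitary.norm_map, ← dist_eq_norm]

end Representation

/-- If the sets `{g | φ 1 - φ g < c}` of a single continuous
positive definite function `φ` form a neighbourhood base of the identity, the representation
attached to `φ` is a topological embedding. -/
theorem IsPositiveDefinite.hilbertRepresentable {G : Type u} [Group G] [TopologicalSpace G]
    [IsTopologicalGroup G] [SeparableSpace G] [T0Space G] {φ : G → ℝ} (h : IsPositiveDefinite φ)
    (hφ : Continuous φ) (hsep : ∀ V ∈ 𝓝 (1 : G), ∃ c > 0, ∀ g, φ 1 - φ g < c → g ∈ V) :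
    HilbertRepresentable.{u, w} G := by
  obtain ⟨H, _, _, _, f, hf, hd⟩ := h.exists_feature_of_separableSpace.{u, w} hφ
  have hfc : Continuous f := continuous_feature hφ hf
  obtain ⟨ρ, hρ⟩ := exists_representation_of_inner_left_invariant (f := f)
    (fun g g₁ g₂ => by rw [hf, hf]; congr 2; group) hd
  have hfi : IsInducing f := by
    refine isInducing_iff_nhds.mpr fun g => le_antisymm (hfc.tendsto g).le_comap fun V hV => ?_
    have hV' : (fun k => g * k) ⁻¹' V ∈ 𝓝 (1 : G) :=
      (continuous_const_mul g).continuousAt.preimage_mem_nhds (by simpa using hV)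
    obtain ⟨c, hc, hcV⟩ := hsep _ hV'
    refine mem_comap.mpr ⟨Metric.ball (f g) √(2 * c), Metric.ball_mem_nhds _ (by positivity),
      fun k hk => ?_⟩
    rw [Set.mem_preimage, Metric.mem_ball', dist_eq_norm, Real.lt_sqrt (norm_nonneg _),
      norm_feature_sub_sq hf] at hk
    simpa using hcV (g⁻¹ * k) (by linarith)
  let ev : G → H → H := fun g x => (ρ g : H →L[ℂ] H) x
  have hev : Continuous ev := continuous_pi fun x =>
    continuous_unitary_apply_of_dense ρ hd (by
      rintro _ ⟨k, rfl⟩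
      simpa only [hρ] using! hfc.comp (continuous_mul_const k)) x
  have hevi : IsInducing ev := by
    refine IsInducing.of_comp hev (continuous_apply (f 1)) ?_
    convert hfi using 1
    ext g
    simp [ev, hρ]
  refine ⟨H, inferInstance, inferInstance, inferInstance, ρ, ?_⟩
  let := unitaryStrongTopology H
  have hind : IsInducing ρ := by
    refine IsInducing.of_comp (continuous_induced_rng.mpr hev) continuous_induced_dom hevi
  exact hind.isEmbedding

/-- Countably many continuous positive definite functions that together control the neighbourhoods
of the identity can be combined into a single one. -/
theorem hilbertRepresentable_of_forall_exists_isPositiveDefinite {G : Type u} [Group G]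
    [TopologicalSpace G] [IsTopologicalGroup G] [SecondCountableTopology G] [T0Space G]
    (hsep : ∀ V ∈ 𝓝 (1 : G), ∃ φ : G → ℝ, IsPositiveDefinite φ ∧ Continuous φ ∧
      ∃ c > 0, ∀ g, φ 1 - φ g < c → g ∈ V) :
    HilbertRepresentable.{u, w} G := by
  obtain ⟨V, hV⟩ := (𝓝 (1 : G)).exists_antitone_basis
  choose φ hφ hφc c hc hcV using fun n => hsep (V n) (hV.1.mem_of_mem trivial)
  -- The weights make the sum of the `φ n` converge uniformly.
  let a : ℕ → ℝ := fun n => (1 / 2) ^ n / (1 + φ n 1)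
  have ha : ∀ n, 0 < a n := fun n => by
    have := (hφ n).apply_one_nonneg
    positivity
  have hbound : ∀ n g, ‖a n * φ n g‖ ≤ (1 / 2) ^ n := by
    intro n g
    have h0 := (hφ n).apply_one_nonneg
    have h1 : |φ n g| ≤ φ n 1 :=
      abs_le.mpr ⟨(hφ n).neg_apply_one_le_apply g, (hφ n).apply_le_apply_one g⟩
    rw [norm_mul, Real.norm_of_nonneg (ha n).le, Real.norm_eq_abs, div_mul_eq_mul_div,
      div_le_iff₀ (by linarith)]
    gcongr
    linarith
  have hsum : ∀ g, Summable fun n => a n * φ n g := fun g =>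
    .of_norm_bounded summable_geometric_two fun n => hbound n g
  let Φ : G → ℝ := fun g => ∑' n, a n * φ n g
  have hΦ : IsPositiveDefinite Φ :=
    .of_hasSum (fun n => (hφ n).smul (ha n).le) fun g => (hsum g).hasSum
  have hΦc : Continuous Φ :=
    continuous_tsum (fun n => (hφc n).const_mul _) summable_geometric_two hbound
  refine hΦ.hilbertRepresentable hΦc fun W hW => ?_
  obtain ⟨n, -, hn⟩ := hV.1.mem_iff.mp hW
  refine ⟨a n * c n, mul_pos (ha n) (hc n), fun g hg => hn (hcV n g ?_)⟩
  have hdiff : HasSum (fun m => a m * φ m 1 - a m * φ m g) (Φ 1 - Φ g) :=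
    (hsum 1).hasSum.sub (hsum g).hasSum
  have hle : a n * φ n 1 - a n * φ n g ≤ Φ 1 - Φ g :=
    le_hasSum hdiff n fun m _ => sub_nonneg.mpr
      (mul_le_mul_of_nonneg_left ((hφ m).apply_le_apply_one g) (ha m).le)
  rw [← mul_sub] at hle
  exact lt_of_mul_lt_mul_left (hle.trans_lt hg) (ha n).le

/-- A Hilbert-representable group carries enough continuous positive definite functions to control
the neighbourhoods of the identity. -/
theorem HilbertRepresentable.exists_isPositiveDefinite {G : Type u} [Group G] [TopologicalSpace G]
    (h : HilbertRepresentable.{u, v} G) {V : Set G} (hV : V ∈ 𝓝 (1 : G)) :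
    ∃ φ : G → ℝ, IsPositiveDefinite φ ∧ Continuous φ ∧ ∃ c > 0, ∀ g, φ 1 - φ g < c → g ∈ V := by
  obtain ⟨H, _, _, _, ρ, hρ⟩ := h
  let := unitaryStrongTopology H
  let ev : G → H → H := fun g x => (ρ g : H →L[ℂ] H) x
  have hev : IsInducing ev := IsInducing.comp (g := fun (U : unitary (H →L[ℂ] H)) (x : H) =>
    (U : H →L[ℂ] H) x) ⟨rfl⟩ hρ.isInducing
  have hρc : ∀ x, Continuous fun g => (ρ g : H →L[ℂ] H) x := fun x =>
    (continuous_apply x).comp hev.continuous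
  rw [hev.nhds_eq_comap, nhds_pi, mem_comap] at hV
  obtain ⟨W, hW, hWV⟩ := hV
  obtain ⟨I, hI, t, ht, htW⟩ := mem_pi.mp hW
  choose r hr hrt using fun x => Metric.mem_nhds_iff.mp (ht x)
  lift I to Finset H using hI
  obtain ⟨ε, hε, hεr⟩ : ∃ ε > 0, ∀ x ∈ I, ε ≤ r x := by
    rcases I.eq_empty_or_nonempty with rfl | hne
    · exact ⟨1, one_pos, by simp⟩
    · obtain ⟨y, -, hy⟩ := I.exists_min_image r hne
      exact ⟨r y, hr y, hy⟩
  -- For unitary `U` one has `‖U x - x‖ ^ 2 = 2 * (‖x‖ ^ 2 - Re ⟪x, U x⟫)`, which explains the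
  -- constant `ε ^ 2 / 2`.
  refine ⟨fun g => ∑ x ∈ I, (inner ℂ x ((ρ g : H →L[ℂ] H) x)).re,
    IsPositiveDefinite.sum I fun x _ => ?_, ?_, ε ^ 2 / 2, by positivity, fun g hg => ?_⟩
  · refine IsPositiveDefinite.of_inner (fun g => (ρ g : H →L[ℂ] H) x) fun g₁ g₂ => ?_
    rw [← Unitary.inner_map_map (ρ g₁) x, ← mul_apply_eq_comp, ← Submonoid.coe_mul,
      ← map_mul, mul_inv_cancel_left]
  · exact continuous_finsetSum _ fun x _ =>
      Complex.continuous_re.comp (continuous_const.inner (hρc x))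
  · refine hWV (htW fun x hx => hrt x ?_)
    have key : ∀ y, ‖ev g y - ev 1 y‖ ^ 2 =
        2 * ((inner ℂ y (ev 1 y)).re - (inner ℂ y (ev g y)).re) := by
      intro y
      have h1 : ev 1 y = y := by simp [ev]
      have h2 : ‖ev g y‖ = ‖y‖ := Unitary.norm_map _ _
      rw [norm_sub_rev, norm_sub_sq (𝕜 := ℂ), h1, h2, ← inner_self_eq_norm_sq (𝕜 := ℂ)]
      simp only [RCLike.re_eq_complex_re]
      ring
    rw [← Finset.sum_sub_distrib] at hg
    have hle : (inner ℂ x (ev 1 x)).re - (inner ℂ x (ev g x)).re < ε ^ 2 / 2 :=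
      (Finset.single_le_sum (f := fun y => (inner ℂ y (ev 1 y)).re - (inner ℂ y (ev g y)).re)
        (fun y _ => by nlinarith [key y, sq_nonneg ‖ev g y - ev 1 y‖]) hx).trans_lt hg
    rw [Metric.mem_ball, dist_eq_norm]
    refine lt_of_lt_of_le (lt_of_pow_lt_pow_left₀ 2 hε.le ?_) (hεr x hx)
    linarith [key x]

/-! ### Averaging over a compact central subgroup -/

section Average

variable {P : Type u} [Group P] [TopologicalSpace P] [IsTopologicalGroup P]
  {K : Subgroup P} [MeasurableSpace K] [BorelSpace K] (μ : Measure K)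

theorem integrable_mul_coe [CompactSpace K] [IsFiniteMeasure μ] {E : Type*}
    [NormedAddCommGroup E] {f : P → E} (hf : Continuous f) (g : P) :
    Integrable (fun k : K => f (g * k)) μ :=
  (show Continuous fun k : K => f (g * k) by fun_prop).integrable_of_hasCompactSupport
    (HasCompactSupport.of_compactSpace _)

/-- The average of a continuous positive definite function over a compact central subgroup is
positive definite: it is the Gram kernel of the averaged feature map. -/
theorem IsPositiveDefinite.integral_mul_coe [CompactSpace K] [IsProbabilityMeasure μ]
    [μ.IsMulLeftInvariant] (hK : ∀ k ∈ K, ∀ g, k * g = g * k) {φ : P → ℝ}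
    (h : IsPositiveDefinite φ) (hφ : Continuous φ) :
    IsPositiveDefinite fun g => ∫ k : K, φ (g * k) ∂μ := by
  obtain ⟨H, _, _, _, f, hf, -⟩ := h.exists_feature
  have hfc : Continuous f := continuous_feature hφ hf
  refine .of_inner (fun g => ∫ k : K, f (g * k) ∂μ) fun g₁ g₂ => ?_
  have h1 : ∀ k : K, inner ℂ (f (g₁ * k)) (∫ l : K, f (g₂ * l) ∂μ) =
      ((∫ l : K, φ (g₁⁻¹ * g₂ * l) ∂μ : ℝ) : ℂ) := by
    intro k
    rw [← integral_inner (integrable_mul_coe μ hfc g₂), ← integral_complex_ofReal,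
      ← integral_mul_left_eq_self (μ := μ) _ k]
    refine integral_congr_ae (.of_forall fun l => ?_)
    simp only [hf, Subgroup.coe_mul]
    have : (g₁ * k : P)⁻¹ * (g₂ * (k * l)) = g₁⁻¹ * g₂ * l :=
      calc (g₁ * k : P)⁻¹ * (g₂ * (k * l)) = (k : P)⁻¹ * (g₁⁻¹ * g₂ * k) * l := by group
        _ = g₁⁻¹ * g₂ * l := by rw [← hK k k.2, inv_mul_cancel_left]
    rw [this]
  have h2 : inner ℂ (∫ k : K, f (g₁ * k) ∂μ) (∫ l : K, f (g₂ * l) ∂μ) =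
      ((∫ l : K, φ (g₁⁻¹ * g₂ * l) ∂μ : ℝ) : ℂ) := by
    rw [← inner_conj_symm, ← integral_inner (integrable_mul_coe μ hfc g₁), ← integral_conj]
    simp only [inner_conj_symm, h1]
    simp
  rw [h2, Complex.ofReal_re]

theorem continuous_integral_mul_coe [FirstCountableTopology P] [CompactSpace K]
    [IsFiniteMeasure μ] {φ : P → ℝ} (hφ : Continuous φ) {C : ℝ} (hC : ∀ g, ‖φ g‖ ≤ C) :
    Continuous fun g => ∫ k : K, φ (g * k) ∂μ :=
  continuous_of_dominated (bound := fun _ => C)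
    (fun g => (integrable_mul_coe μ hφ g).aestronglyMeasurable)
    (fun g => .of_forall fun k => hC _) (integrable_const C)
    (.of_forall fun k => by fun_prop)

/-- The average over `K` is invariant under `K`. -/
theorem integral_mul_coe_mul [μ.IsMulLeftInvariant] (φ : P → ℝ) (g : P) (k : K) :
    ∫ l : K, φ (g * k * l) ∂μ = ∫ l : K, φ (g * l) ∂μ := by
  rw [← integral_mul_left_eq_self (μ := μ) (fun l : K => φ (g * l)) k]
  simp [mul_assoc]

/-- If `φ` controls the neighbourhood `V` of the identity, the averages of `exp (N * φ)` over the
compact central subgroup `K` control `V * K` once `N` is large: off `V * K` the integrand is at most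
`exp (N * (φ 1 - c))`, and on a neighbourhood of the identity of `K` it is at least
`exp (N * (φ 1 - c / 2))`. -/
theorem IsPositiveDefinite.exists_average [FirstCountableTopology P] [CompactSpace K]
    [μ.IsOpenPosMeasure] [IsProbabilityMeasure μ] [μ.IsMulLeftInvariant]
    (hK : ∀ k ∈ K, ∀ g, k * g = g * k) {φ : P → ℝ} (h : IsPositiveDefinite φ)
    (hφ : Continuous φ) {V : Set P} {c : ℝ} (hc : 0 < c)
    (hV : ∀ g, φ 1 - φ g < c → g ∈ V) :
    ∃ ψ : P → ℝ, IsPositiveDefinite ψ ∧ Continuous ψ ∧ (∀ g, ∀ k ∈ K, ψ (g * k) = ψ g) ∧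
      ∃ d > 0, ∀ g, ψ 1 - ψ g < d → ∃ k ∈ K, g * k ∈ V := by
  let W : Set K := {k | φ 1 - c / 2 < φ k}
  have hWo : IsOpen W := isOpen_lt continuous_const (by fun_prop)
  have hW : 0 < μ.real W := by
    refine ENNReal.toReal_pos (hWo.measure_pos μ ⟨1, ?_⟩).ne' (measure_ne_top _ _)
    simp only [W, Set.mem_ofPred_eq, Subgroup.coe_one]
    linarith
  obtain ⟨N, hN⟩ : ∃ N : ℕ, Real.exp (-(N * (c / 2))) < μ.real W := by
    have : Tendsto (fun N : ℕ => Real.exp (-(N * (c / 2)))) atTop (𝓝 0) :=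
      Real.tendsto_exp_neg_atTop_nhds_zero.comp
        (tendsto_natCast_atTop_atTop.atTop_mul_const (by positivity))
    exact (this.eventually_lt_const hW).exists
  let θ : P → ℝ := fun g => Real.exp (N * φ g)
  have hθ : IsPositiveDefinite θ := (h.smul N.cast_nonneg).exp
  have hθc : Continuous θ := by fun_prop
  let ψ : P → ℝ := fun g => ∫ k : K, θ (g * k) ∂μ
  have hlow : Real.exp (N * (φ 1 - c / 2)) * μ.real W ≤ ψ 1 := by
    have h1 : ∫ k in W, Real.exp (N * (φ 1 - c / 2)) ∂μ ≤ ∫ k in W, θ (1 * k) ∂μ := by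
      refine setIntegral_mono_on (integrable_const _) (integrable_mul_coe μ hθc 1).integrableOn
        hWo.measurableSet fun k hk => ?_
      rw [one_mul]
      exact Real.exp_le_exp.mpr (mul_le_mul_of_nonneg_left (le_of_lt hk) N.cast_nonneg)
    rw [setIntegral_const, smul_eq_mul, mul_comm] at h1
    exact h1.trans (setIntegral_le_integral (integrable_mul_coe μ hθc 1)
      (.of_forall fun k => (Real.exp_pos _).le))
  have hup : ∀ g, (∀ k ∈ K, g * k ∉ V) → ψ g ≤ Real.exp (N * (φ 1 - c)) := by
    intro g hg
    have : ψ g ≤ ∫ _ : K, Real.exp (N * (φ 1 - c)) ∂μ := by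
      refine integral_mono (integrable_mul_coe μ hθc g) (integrable_const _) fun k => ?_
      refine Real.exp_le_exp.mpr (mul_le_mul_of_nonneg_left ?_ N.cast_nonneg)
      by_contra hlt
      exact hg k k.2 (hV _ (by linarith))
    simpa using this
  have hgap : Real.exp (N * (φ 1 - c)) < ψ 1 := by
    refine lt_of_lt_of_le ?_ hlow
    have : Real.exp (N * (φ 1 - c)) =
        Real.exp (N * (φ 1 - c / 2)) * Real.exp (-(N * (c / 2))) := by
      rw [← Real.exp_add]
      ring_nf
    rw [this]
    exact mul_lt_mul_of_pos_left hN (Real.exp_pos _)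
  refine ⟨ψ, hθ.integral_mul_coe μ hK hθc, continuous_integral_mul_coe μ hθc (C := θ 1) fun g => ?_,
    fun g k hk => integral_mul_coe_mul μ θ g ⟨k, hk⟩, ψ 1 - Real.exp (N * (φ 1 - c)),
    sub_pos.mpr hgap, fun g hg => ?_⟩
  · rw [Real.norm_of_nonneg (Real.exp_pos _).le]
    exact hθ.apply_le_apply_one g
  · by_contra! hne
    linarith [hup g hne]

end Average

/-- A group whose topology is controlled by continuous positive definite functions keeps this
property after division by a compact central subgroup. -/
theorem exists_isPositiveDefinite_quotient {P : Type u} [Group P] [TopologicalSpace P]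
    [IsTopologicalGroup P] [FirstCountableTopology P] [T2Space P] {K : Subgroup P} [K.Normal]
    (hKc : IsCompact (K : Set P)) (hK : ∀ k ∈ K, ∀ g, k * g = g * k)
    (h : ∀ V ∈ 𝓝 (1 : P), ∃ φ : P → ℝ, IsPositiveDefinite φ ∧ Continuous φ ∧
      ∃ c > 0, ∀ g, φ 1 - φ g < c → g ∈ V) {O : Set (P ⧸ K)} (hO : O ∈ 𝓝 (1 : P ⧸ K)) :
    ∃ φ : P ⧸ K → ℝ, IsPositiveDefinite φ ∧ Continuous φ ∧ ∃ c > 0, ∀ g, φ 1 - φ g < c → g ∈ O := by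
  have : CompactSpace K := isCompact_iff_compactSpace.mp hKc
  let : MeasurableSpace K := borel K
  have : BorelSpace K := ⟨rfl⟩
  let μ : Measure K := Measure.haarMeasure ⊤
  have : IsProbabilityMeasure μ := ⟨Measure.haarMeasure_self (K₀ := (⊤ : PositiveCompacts K))⟩
  obtain ⟨φ, hφ, hφc, c, hc, hcV⟩ := h ((QuotientGroup.mk : P → P ⧸ K) ⁻¹' O)
    (continuous_quotient_mk'.continuousAt.preimage_mem_nhds hO)
  obtain ⟨ψ, hψ, hψc, hψK, d, hd, hdV⟩ := hφ.exists_average μ hK hφc hc hcV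
  let ψ' : P ⧸ K → ℝ := Quotient.lift ψ fun a b hab => by
    rw [← hψK a _ (QuotientGroup.leftRel_apply.mp hab), mul_inv_cancel_left]
  have hψ' : ∀ g : P, ψ' g = ψ g := fun g => rfl
  refine ⟨ψ', ?_, hψc.quotient_lift _, d, hd, fun a ha => ?_⟩
  · have := Matrix.PosSemidef.submatrix hψ (Quotient.out : P ⧸ K → P)
    have e : (Matrix.of fun g h => ψ' (g⁻¹ * h)) =
        (Matrix.of fun g h => ψ (g⁻¹ * h)).submatrix Quotient.out Quotient.out := by
      ext a b
      rw [Matrix.submatrix_apply, Matrix.of_apply, Matrix.of_apply, ← hψ', QuotientGroup.mk_mul,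
        QuotientGroup.mk_inv, QuotientGroup.out_eq', QuotientGroup.out_eq']
    rwa [IsPositiveDefinite, e]
  · induction a using QuotientGroup.induction_on with | H g =>
    rw [hψ', ← QuotientGroup.mk_one, hψ'] at ha
    obtain ⟨k, hk, hgk⟩ := hdV g ha
    rw [Set.mem_preimage] at hgk
    have e : (g : P ⧸ K) = (g * k : P) := QuotientGroup.eq.mpr (by simpa using hk)
    rwa [e]

theorem IsMonothetic.mul_comm {P : Type u} [Group P] [TopologicalSpace P] [IsTopologicalGroup P]
    [T2Space P] (h : IsMonothetic P) (a b : P) : a * b = b * a := by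
  obtain ⟨g, hg⟩ := h
  have hl : Continuous fun x : P × P => x.1 * x.2 := by fun_prop
  have hr : Continuous fun x : P × P => x.2 * x.1 := by fun_prop
  refine congrFun ((hg.prodMap hg).equalizer hl hr (funext fun n => ?_)) (a, b)
  exact ((Commute.refl g).zpow_zpow n.1 n.2).eq

/-- The hypothesis and the conclusion allow Hilbert spaces in arbitrary, unrelated universes.
Normality of `K`, without which `P ⧸ K` is no group, and Polishness of the quotient group are
part of the conclusion. -/
theorem corollary5p3 (P : Type u) [Group P] [TopologicalSpace P] [IsTopologicalGroup P]
    [PolishSpace P] (hmono : IsMonothetic P) (hrep : HilbertRepresentable.{u, v} P)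
    (K : Subgroup P) (hK : IsCompact (K : Set P)) :
    ∃ _ : K.Normal, PolishSpace (P ⧸ K) ∧ HilbertRepresentable.{u, w} (P ⧸ K) := by
  have comm := hmono.mul_comm
  have hN : K.Normal := ⟨fun k hk g => by rwa [comm g k, mul_inv_cancel_right]⟩
  have hPolish := polishSpace_quotient_of_isCompact K hK
  exact ⟨hN, hPolish, hilbertRepresentable_of_forall_exists_isPositiveDefinite fun O hO =>
    exists_isPositiveDefinite_quotient hK (fun k _ g => comm k g)
      (fun V hV => hrep.exists_isPositiveDefinite hV) hO⟩
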